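/- Let $d\ge 1$ and let $\mathcal P_d$ be the collection of convex polytopes in $\mathbb R^d$ all of whose vertices lie on the unit sphere $\mathbb S^{d-1}$, which contain the origin in their interior and have non-zero $d$-dimensional volume. Let $T\in\mathcal P_d$ be a simplex with vertices $v_1,\dots,v_{d+1}$. Let $\mathrm{vol}_d(T)=(\mathrm{vol}_d(T_1),\dots,\mathrm{vol}_d(T_{d+1}))$ be its vector of cone volumes, where $T_j$ is the convex hull of the origin and the vertices $v_i$, $i\ne j$, and let $\mathrm{vol}_1(T)=(\|v_i-v_j\|)_{1\le i<j\le d+1}$ be its vector of edge lengths. For a finite vector $y$ put $\|y\|_{\ell_p}=\big(\sum_j|y_j|^p\big)^{1/p}$. Then for every real $p$ with $1\le p\le 2$, $$\|\mathrm{vol}_d(T)\|_{\ell_p}\le\frac{(d+1)^{\frac{3d-1}{2}-\frac{2d-1}{p}}}{d!\,d^{d/2}}\;\|\mathrm{vol}_1(T)\|_{\ell_2}^{\,d\left(\frac2p-1\right)},$$ with equality if and only if $T$ is a regular simplex. -/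

import Mathlib

open MeasureTheory

/-- The class `𝒫_d`: convex polytopes in `ℝ^d` (convex hulls of finitely many points) all of whose
vertices lie on the unit sphere, which contain the origin in their interior and have non-zero
`d`-dimensional volume. -/
def InscribedPolytopes (d : ℕ) : Set (Set (EuclideanSpace ℝ (Fin d))) :=
  {P | (∃ s : Finset (EuclideanSpace ℝ (Fin d)), P = convexHull ℝ (s : Set _)) ∧
    P.extremePoints ℝ ⊆ Metric.sphere 0 1 ∧ 0 ∈ interior P ∧ volume P ≠ 0}

/-- The `ℓ_p` norm `(∑ |y_j|^p)^{1/p}` of a finite family of real numbers. -/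
noncomputable def ellNorm {ι : Type*} [Fintype ι] (p : ℝ) (y : ι → ℝ) : ℝ :=
  (∑ j, |y j| ^ p) ^ (1 / p)

/-- The vector of cone volumes of a simplex `T` in `ℝ^d`. Its `j`-th entry is the `d`-dimensional
volume of the cone from the origin over the facet of `T` opposite the `j`-th vertex, that is, of
the convex hull of the points obtained from the vertices by replacing the `j`-th one with `0`. -/
noncomputable def coneVolumes {d : ℕ} (T : Affine.Simplex ℝ (EuclideanSpace ℝ (Fin d)) d) :
    Fin (d + 1) → ℝ :=
  fun j => volume.real (convexHull ℝ (insert 0 (T.points '' {j}ᶜ)))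

/-- The vector of edge lengths of a simplex `T` in `ℝ^d`, indexed by the pairs `i < j`. -/
noncomputable def edgeLengths {d : ℕ} (T : Affine.Simplex ℝ (EuclideanSpace ℝ (Fin d)) d) :
    {e : Fin (d + 1) × Fin (d + 1) // e.1 < e.2} → ℝ :=
  fun e => dist (T.points e.1.1) (T.points e.1.2)

/-!
Write the origin as `∑ l i • v i` with barycentric coordinates `l i`, which are positive because the
origin is interior, and let `D` be the determinant of the matrix with rows `(1, v i)`. The signed
maximal minors of the matrix `W` with rows `v i` form a linear relation between the vertices, hence
are equal to `l i * D` (`AffineIndependent.signedMinor_eq`), and the cone volumes are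
`l i * |D| / d!`.

If `∑ u i • w i = 0`, the first column of the square matrix `[u | W]` with rows `(u i, w i)` is
orthogonal to the other columns, so that `det [u | W] ^ 2 = (∑ u i ^ 2) * det (Wᵀ * W)`, and AM-GM
for the eigenvalues of `Wᵀ * W` bounds this by `(∑ u i ^ 2) * ((∑ ‖w i‖ ^ 2) / d) ^ d`
(`det_consCol_sq_le`). Two choices are used.

* `u = 1` and `w i = v i - g` with `g` the centroid: here `(d + 1) * ∑ ‖w i‖ ^ 2` is the sum of the
  squared edge lengths, and the result bounds the sum of the cone volumes (exponent one).
* `u = l` and `w i = v i`: here `∑ ‖w i‖ ^ 2 = d + 1`, and the result bounds the sum of the squares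
  of the cone volumes (exponent two).

Hölder's inequality (`ellNorm_le_of_nonneg`) interpolates between the two exponents. Equality in
either determinant bound means that `Wᵀ * W` is scalar; then the rows of the rescaled matrix
`[u | W]` are orthogonal as well (`dotProduct_eq_of_det_consCol_sq_eq`), which makes the simplex
equilateral. Equilateral simplices are regular (`Affine.Simplex.regular_iff_equilateral`), and an
inscribed one around the origin attains both bounds with constant cone volumes.
-/

section

open Matrix

variable {d : ℕ}

/-! ### The arithmetic-geometric mean inequality for determinants -/

/-- The unweighted AM-GM inequality in a root-free form, with its equality case. -/
theorem prod_le_pow_arith_mean {n : ℕ} (hn : n ≠ 0) (z : Fin n → ℝ) (hz : ∀ i, 0 ≤ z i) :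
    ∏ i, z i ≤ ((∑ i, z i) / n) ^ n ∧
      (∏ i, z i = ((∑ i, z i) / n) ^ n → ∀ i, z i = (∑ i, z i) / n) := by
  have hn' : (0 : ℝ) < n := by positivity
  have hw : ∑ _i : Fin n, (1 / (n : ℝ)) = 1 := by simp [hn'.ne']
  have hg : (∏ i, z i ^ (1 / (n : ℝ))) ^ n = ∏ i, z i := by
    rw [← Finset.prod_pow]
    refine Finset.prod_congr rfl fun i _ => ?_
    rw [← Real.rpow_natCast, ← Real.rpow_mul (hz i)]
    simp [hn'.ne']
  have hm : ∑ i, (1 / (n : ℝ)) * z i = (∑ i, z i) / n := by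
    rw [← Finset.mul_sum]; ring
  have hg0 : 0 ≤ ∏ i, z i ^ (1 / (n : ℝ)) :=
    Finset.prod_nonneg fun i _ => Real.rpow_nonneg (hz i) _
  have hm0 : 0 ≤ (∑ i, z i) / n := div_nonneg (Finset.sum_nonneg fun i _ => hz i) hn'.le
  constructor
  · rw [← hg, ← hm]
    exact pow_le_pow_left₀ hg0 (Real.geom_mean_le_arith_mean_weighted _ _ _
      (fun _ _ => by positivity) hw (fun i _ => hz i)) n
  · intro h i
    rw [← hg] at h
    have h' := (pow_left_inj₀ hg0 hm0 hn).1 h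
    rw [← hm] at h' ⊢
    exact (Real.geom_mean_eq_arith_mean_weighted_iff_of_pos' Finset.univ (fun _ => 1 / (n : ℝ)) z
      (fun _ _ => by positivity) hw (fun i _ => hz i)).1 h' i (Finset.mem_univ i)

/-- AM-GM for the eigenvalues of a positive semidefinite matrix. -/
theorem Matrix.PosSemidef.det_le_trace_div_pow {n : ℕ} (hn : n ≠ 0) {M : Matrix (Fin n) (Fin n) ℝ}
    (hM : M.PosSemidef) : M.det ≤ (M.trace / n) ^ n := by
  rw [hM.isHermitian.det_eq_prod_eigenvalues, hM.isHermitian.trace_eq_sum_eigenvalues]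
  exact (prod_le_pow_arith_mean hn _ hM.eigenvalues_nonneg).1

/-- In the equality case all eigenvalues coincide, so the matrix is scalar. -/
theorem Matrix.PosSemidef.eq_smul_one_of_det_eq {n : ℕ} (hn : n ≠ 0)
    {M : Matrix (Fin n) (Fin n) ℝ} (hM : M.PosSemidef) (h : M.det = (M.trace / n) ^ n) :
    M = (M.trace / n) • (1 : Matrix (Fin n) (Fin n) ℝ) := by
  have ht : M.trace = ∑ i, hM.isHermitian.eigenvalues i :=
    hM.isHermitian.trace_eq_sum_eigenvalues
  have hd : M.det = ∏ i, hM.isHermitian.eigenvalues i :=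
    hM.isHermitian.det_eq_prod_eigenvalues
  have key := (prod_le_pow_arith_mean hn _ hM.eigenvalues_nonneg).2 (by rw [← hd, ← ht, h])
  rw [← ht] at key
  have hs := hM.isHermitian.spectral_theorem
  have hdiag : diagonal (RCLike.ofReal ∘ hM.isHermitian.eigenvalues : Fin n → ℝ)
      = (M.trace / n) • (1 : Matrix (Fin n) (Fin n) ℝ) := by
    ext i j
    by_cases hij : i = j <;> simp [Matrix.diagonal, hij, key]
  rw [hdiag] at hs
  conv_lhs => rw [hs]
  simp

/-! ### Square matrices obtained by adjoining a column -/

/-- The square matrix `[u | W]`: the column `u` followed by the columns of `W`. -/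
def consCol {d : ℕ} (u : Fin (d + 1) → ℝ) (W : Matrix (Fin (d + 1)) (Fin d) ℝ) :
    Matrix (Fin (d + 1)) (Fin (d + 1)) ℝ :=
  Matrix.of fun i => Fin.cons (u i) (W i)

/-- The signed maximal minor of `W` with the row `i` deleted, that is, the cofactor of the `i`-th
entry of the first column in `[u | W]`. -/
def signedMinor {d : ℕ} (W : Matrix (Fin (d + 1)) (Fin d) ℝ) (i : Fin (d + 1)) : ℝ :=
  (-1) ^ (i : ℕ) * (W.submatrix i.succAbove id).det

theorem det_consCol (u : Fin (d + 1) → ℝ) (W : Matrix (Fin (d + 1)) (Fin d) ℝ) :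
    (consCol u W).det = ∑ i, u i * signedMinor W i := by
  rw [Matrix.det_succ_column_zero]
  refine Finset.sum_congr rfl fun i _ => ?_
  have : (consCol u W).submatrix i.succAbove Fin.succ = W.submatrix i.succAbove id := by
    ext a b; simp [consCol]
  rw [this]
  simp [consCol, signedMinor]
  ring

/-- The vector of signed minors is a linear relation between the rows of `W`: its pairing with a
column of `W` is the determinant of a matrix with a repeated column. -/
theorem sum_signedMinor_mul (W : Matrix (Fin (d + 1)) (Fin d) ℝ) (k : Fin d) :
    ∑ i, signedMinor W i * W i k = 0 := by
  have h := det_consCol (fun i => W i k) W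
  rw [Matrix.det_zero_of_column_eq (i := 0) (j := k.succ) (Fin.succ_ne_zero k).symm] at h
  · rw [h]; exact Finset.sum_congr rfl fun i _ => mul_comm _ _
  · intro i; simp [consCol]

/-- If `u` is orthogonal to the columns of `W`, the Gram matrix of the columns of `[u | W]` is block
diagonal with blocks `∑ u i ^ 2` and `Wᵀ * W`. -/
theorem consCol_transpose_mul_self (u : Fin (d + 1) → ℝ) (W : Matrix (Fin (d + 1)) (Fin d) ℝ)
    (huW : ∀ k, ∑ i, u i * W i k = 0) :
    (consCol u W)ᵀ * consCol u W =
      Matrix.of (Fin.cons (Fin.cons (∑ i, u i ^ 2) 0) fun k => Fin.cons 0 ((Wᵀ * W) k)) := by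
  ext a b
  refine Fin.cases ?_ (fun a => ?_) a <;> refine Fin.cases ?_ (fun b => ?_) b
  · simp [Matrix.mul_apply, consCol, sq]
  · simpa [Matrix.mul_apply, consCol] using huW b
  · simpa [Matrix.mul_apply, consCol, mul_comm] using huW a
  · simp [Matrix.mul_apply, consCol]

theorem det_consCol_sq (u : Fin (d + 1) → ℝ) (W : Matrix (Fin (d + 1)) (Fin d) ℝ)
    (huW : ∀ k, ∑ i, u i * W i k = 0) :
    (consCol u W).det ^ 2 = (∑ i, u i ^ 2) * (Wᵀ * W).det := by
  have h : (consCol u W).det ^ 2 = ((consCol u W)ᵀ * consCol u W).det := by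
    rw [Matrix.det_mul, Matrix.det_transpose, sq]
  rw [h, consCol_transpose_mul_self u W huW, Matrix.det_succ_row_zero, Fin.sum_univ_succ]
  have h0 : (Matrix.of (Fin.cons (Fin.cons (∑ i, u i ^ 2) 0)
      fun k => Fin.cons 0 ((Wᵀ * W) k)) : Matrix (Fin (d + 1)) (Fin (d + 1)) ℝ).submatrix
        Fin.succ (Fin.succAbove 0) = Wᵀ * W := by
    ext a b; simp
  rw [h0]
  simp

theorem posSemidef_transpose_mul_self (W : Matrix (Fin (d + 1)) (Fin d) ℝ) :
    (Wᵀ * W).PosSemidef := by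
  simpa using Matrix.posSemidef_conjTranspose_mul_self W

theorem trace_transpose_mul_self (W : Matrix (Fin (d + 1)) (Fin d) ℝ) :
    (Wᵀ * W).trace = ∑ i, W i ⬝ᵥ W i := by
  rw [Matrix.trace, Finset.sum_congr rfl fun i _ => Matrix.diag_apply _ _]
  simp only [Matrix.mul_apply, dotProduct, Matrix.transpose_apply]
  exact Finset.sum_comm

/-- The determinant bound from which both extreme cases of the inequality are obtained, by choosing
the relation `u` between the rows of `W`. -/
theorem det_consCol_sq_le (hd : d ≠ 0) (u : Fin (d + 1) → ℝ) (W : Matrix (Fin (d + 1)) (Fin d) ℝ)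
    (huW : ∀ k, ∑ i, u i * W i k = 0) :
    (consCol u W).det ^ 2 ≤ (∑ i, u i ^ 2) * ((∑ i, W i ⬝ᵥ W i) / d) ^ d := by
  rw [det_consCol_sq u W huW, ← trace_transpose_mul_self]
  exact mul_le_mul_of_nonneg_left ((posSemidef_transpose_mul_self W).det_le_trace_div_pow hd)
    (Finset.sum_nonneg fun i _ => sq_nonneg _)

/-- Equality in `det_consCol_sq_le` makes the columns of `[u | W]`, suitably rescaled, orthogonal and
of the same length; hence so are its rows, which determines the Gram matrix of the rows of `W`. -/
theorem dotProduct_eq_of_det_consCol_sq_eq (hd : d ≠ 0) (u : Fin (d + 1) → ℝ)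
    (W : Matrix (Fin (d + 1)) (Fin d) ℝ) (huW : ∀ k, ∑ i, u i * W i k = 0)
    (hu : 0 < ∑ i, u i ^ 2) (hW : 0 < ∑ i, W i ⬝ᵥ W i)
    (h : (consCol u W).det ^ 2 = (∑ i, u i ^ 2) * ((∑ i, W i ⬝ᵥ W i) / d) ^ d) (i j : Fin (d + 1)) :
    W i ⬝ᵥ W j = (∑ i, W i ⬝ᵥ W i) / d *
      ((if i = j then 1 else 0) - u i * u j / ∑ i, u i ^ 2) := by
  rw [det_consCol_sq u W huW, ← trace_transpose_mul_self] at h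
  have hM := (posSemidef_transpose_mul_self W).eq_smul_one_of_det_eq hd
    (mul_left_cancel₀ hu.ne' h)
  rw [trace_transpose_mul_self] at hM
  set c := (∑ i, W i ⬝ᵥ W i) / d with hc
  set s := ∑ i, u i ^ 2 with hs
  have hc0 : 0 < c := div_pos hW (by positivity)
  -- Rescaling the first column makes all columns orthogonal of squared length `c`.
  set t := √(c / s) with ht
  have ht2 : t ^ 2 = c / s := Real.sq_sqrt (div_nonneg hc0.le hu.le)
  have hC : (consCol (fun i => t * u i) W)ᵀ * consCol (fun i => t * u i) W
      = c • (1 : Matrix _ _ ℝ) := by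
    rw [consCol_transpose_mul_self, hM]
    · have hts : ∑ i, (t * u i) ^ 2 = c := by
        simp only [mul_pow, ← Finset.mul_sum, ht2, ← hs]
        field_simp
      rw [hts]
      ext a b
      refine Fin.cases ?_ (fun a => ?_) a <;> refine Fin.cases ?_ (fun b => ?_) b <;>
        simp [Matrix.one_apply, (Fin.succ_ne_zero _).symm]
    · intro k
      simp only [mul_assoc, ← Finset.mul_sum, huW, mul_zero]
  have hC' : consCol (fun i => t * u i) W * (consCol (fun i => t * u i) W)ᵀ
      = c • (1 : Matrix _ _ ℝ) := by
    have h1 : (c⁻¹ • (consCol (fun i => t * u i) W)ᵀ) * consCol (fun i => t * u i) W = 1 := by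
      rw [Matrix.smul_mul, hC, smul_smul, inv_mul_cancel₀ hc0.ne', one_smul]
    have h2 := mul_eq_one_comm.1 h1
    rw [Matrix.mul_smul] at h2
    rw [← h2, smul_smul, mul_inv_cancel₀ hc0.ne', one_smul]
  have hij := congrFun (congrFun hC' i) j
  rw [Matrix.mul_apply, Fin.sum_univ_succ] at hij
  simp only [Matrix.transpose_apply, consCol, Matrix.of_apply, Fin.cons_zero, Fin.cons_succ,
    Matrix.smul_apply, Matrix.one_apply, smul_eq_mul] at hij
  have : t * u i * (t * u j) = c * (u i * u j / s) := by
    rw [show t * u i * (t * u j) = t ^ 2 * (u i * u j) by ring, ht2]; ring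
  rw [this] at hij
  change ∑ k, W i k * W j k = _
  linarith

/-! ### Volume of a simplex with a vertex at the origin -/

/-- By induction on the dimension, slicing along the first coordinate. -/
theorem volume_cornerSimplex (n : ℕ) (t : ℝ) (ht : 0 ≤ t) :
    volume {x : Fin n → ℝ | (∀ i, 0 ≤ x i) ∧ ∑ i, x i ≤ t} = ENNReal.ofReal (t ^ n / n.factorial) := by
  induction n generalizing t with
  | zero => simp [ht, volume_pi]
  | succ n ih =>
    set e := MeasurableEquiv.piFinSuccAbove (fun _ : Fin (n + 1) => ℝ) 0
    have he : MeasurePreserving e := volume_preserving_piFinSuccAbove (fun _ => ℝ) 0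
    set B : Set (ℝ × (Fin n → ℝ)) := {q | 0 ≤ q.1 ∧ (∀ i, 0 ≤ q.2 i) ∧ q.1 + ∑ i, q.2 i ≤ t}
    have hB : MeasurableSet B := by
      apply IsClosed.measurableSet
      simp only [B, Set.ofPred_and, Set.ofPred_forall]
      refine (isClosed_le (by fun_prop) (by fun_prop)).inter
        ((isClosed_iInter fun i => isClosed_le (by fun_prop) (by fun_prop)).inter
          (isClosed_le (by fun_prop) (by fun_prop)))
    have hpre : {x : Fin (n + 1) → ℝ | (∀ i, 0 ≤ x i) ∧ ∑ i, x i ≤ t} = e ⁻¹' B := by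
      ext x
      simp [B, e, Fin.forall_fin_succ, Fin.sum_univ_succ, MeasurableEquiv.piFinSuccAbove,
        and_assoc, Fin.tail]
    rw [hpre, he.measure_preimage hB.nullMeasurableSet, Measure.volume_eq_prod,
      Measure.prod_apply hB]
    have hslice : ∀ s : ℝ, volume (Prod.mk s ⁻¹' B)
        = (Set.Icc 0 t).indicator (fun s => ENNReal.ofReal ((t - s) ^ n / n.factorial)) s := by
      intro s
      by_cases hs : s ∈ Set.Icc 0 t
      · rw [Set.indicator_of_mem hs, ← ih (t - s) (by linarith [hs.2])]
        congr 1
        ext y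
        simp [B, hs.1, le_sub_iff_add_le']
      · rw [Set.indicator_of_notMem hs]
        convert measure_empty (μ := (volume : Measure (Fin n → ℝ)))
        rw [Set.eq_empty_iff_forall_notMem]
        rintro y ⟨h1, h2, h3⟩
        exact hs ⟨h1, le_trans (le_add_of_nonneg_right (Finset.sum_nonneg fun i _ => h2 i)) h3⟩
    simp_rw [hslice]
    rw [lintegral_indicator measurableSet_Icc, ← ofReal_integral_eq_lintegral_ofReal]
    · congr 1
      rw [integral_Icc_eq_integral_Ioc, ← intervalIntegral.integral_of_le ht,
        intervalIntegral.integral_div, intervalIntegral.integral_comp_sub_left (fun s => s ^ n) t]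
      simp only [sub_self, sub_zero, integral_pow, Nat.factorial_succ]
      push_cast
      have : ((n : ℝ) + 1) ≠ 0 := by positivity
      have : (n.factorial : ℝ) ≠ 0 := by positivity
      field_simp
      simp
    · exact (Continuous.continuousOn (by fun_prop)).integrableOn_Icc
    · filter_upwards [ae_restrict_mem measurableSet_Icc] with s hs
      have : 0 ≤ t - s := by linarith [hs.2]
      positivity

theorem convexHull_insert_zero_range_single (n : ℕ) :
    convexHull ℝ (insert 0 (Set.range fun i : Fin n => (Pi.single i 1 : Fin n → ℝ)))
      = {x | (∀ i, 0 ≤ x i) ∧ ∑ i, x i ≤ 1} := by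
  apply Set.Subset.antisymm
  · refine convexHull_min ?_ ?_
    · rintro x (rfl | ⟨i, rfl⟩)
      · simp
      · refine ⟨fun j => ?_, by simp⟩
        by_cases h : j = i <;> simp [h]
    · intro x hx y hy a b ha hb hab
      refine ⟨fun i => ?_, ?_⟩
      · have := hx.1 i
        have := hy.1 i
        simp only [Pi.add_apply, Pi.smul_apply, smul_eq_mul]
        positivity
      · simp only [Pi.add_apply, Pi.smul_apply, smul_eq_mul, Finset.sum_add_distrib,
          ← Finset.mul_sum]
        nlinarith [hx.2, hy.2]
  · rintro x ⟨h0, h1⟩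
    have h := (convex_convexHull ℝ
      (insert 0 (Set.range fun i : Fin n => (Pi.single i 1 : Fin n → ℝ)))).sum_mem
      (t := Finset.univ) (w := fun o : Option (Fin n) => o.elim (1 - ∑ i, x i) x)
      (z := fun o => o.elim 0 fun i => Pi.single i 1) ?_ ?_ ?_
    · convert h
      rw [Fintype.sum_option]
      ext j
      simp [Finset.sum_apply, Pi.single_apply]
    · rintro (_ | i) _
      · simpa using h1
      · exact h0 i
    · simp [Fintype.sum_option]
    · rintro (_ | i) _
      · exact subset_convexHull ℝ _ (Set.mem_insert _ _)
      · exact subset_convexHull ℝ _ (Set.mem_insert_of_mem _ ⟨i, rfl⟩)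

/-- The simplex with vertices `0, v 0, …, v (n - 1)` is a linear image of the corner simplex. The
points `v i` need not be independent. -/
theorem volume_real_convexHull_insert_zero_range {n : ℕ} (v : Fin n → EuclideanSpace ℝ (Fin n)) :
    volume.real (convexHull ℝ (insert 0 (Set.range v)))
      = |(Matrix.of fun i k => v i k).det| / n.factorial := by
  set A : Matrix (Fin n) (Fin n) ℝ := Matrix.of fun i k => v i k
  set f : (Fin n → ℝ) →ₗ[ℝ] (Fin n → ℝ) := Matrix.toLin' A.transpose
  have himg : convexHull ℝ (insert 0 (Set.range v)) =
      (MeasurableEquiv.toLp 2 (Fin n → ℝ)).symm ⁻¹'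
        (f '' {x | (∀ i, 0 ≤ x i) ∧ ∑ i, x i ≤ 1}) := by
    have h1 : (MeasurableEquiv.toLp 2 (Fin n → ℝ)).symm ⁻¹'
        (f '' {x | (∀ i, 0 ≤ x i) ∧ ∑ i, x i ≤ 1}) =
        (WithLp.linearEquiv 2 ℝ (Fin n → ℝ)).symm.toLinearMap ''
        (f '' {x | (∀ i, 0 ≤ x i) ∧ ∑ i, x i ≤ 1}) :=
      ((WithLp.linearEquiv 2 ℝ (Fin n → ℝ)).symm.toEquiv.image_eq_preimage_symm _).symm
    rw [h1, ← convexHull_insert_zero_range_single, LinearMap.image_convexHull,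
      LinearMap.image_convexHull, Set.image_insert_eq, Set.image_insert_eq, map_zero, map_zero,
      ← Set.range_comp, ← Set.range_comp]
    congr 3
    ext i k
    simp [f, A]
  rw [himg, measureReal_def,
    (EuclideanSpace.volume_preserving_symm_measurableEquiv_toLp (Fin n)).measure_preimage_equiv,
    Measure.addHaar_image_linearMap, volume_cornerSimplex n 1 zero_le_one,
    ENNReal.toReal_mul, ENNReal.toReal_ofReal (abs_nonneg _),
    ENNReal.toReal_ofReal (by positivity), LinearMap.det_toLin', Matrix.det_transpose]
  simp [div_eq_mul_inv]

/-! ### Minors, weights and edge lengths of a family of points -/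

/-- The matrix whose rows are the coordinate vectors of a family of points. -/
def coordMatrix {m : ℕ} (v : Fin m → EuclideanSpace ℝ (Fin d)) : Matrix (Fin m) (Fin d) ℝ :=
  Matrix.of fun i => v i

theorem coordMatrix_apply {m : ℕ} (v : Fin m → EuclideanSpace ℝ (Fin d)) (i : Fin m) :
    coordMatrix v i = (v i).ofLp := rfl

/-- Column operations show that translating the points does not change `det [1 | W]`. -/
theorem det_consCol_sub_const (W : Matrix (Fin (d + 1)) (Fin d) ℝ) (g : Fin d → ℝ) :
    (consCol (fun _ => 1) (Matrix.of fun i => W i - g)).det = (consCol (fun _ => 1) W).det := by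
  rw [← Matrix.det_transpose, ← Matrix.det_transpose (consCol _ W)]
  refine Matrix.det_eq_of_forall_row_eq_smul_add_const (Fin.cons 0 fun k => - g k) 0 (by simp) ?_
  intro j i
  refine Fin.cases ?_ (fun j => ?_) j
  · simp [consCol]
  · simp [consCol]
    ring

/-- An affinely independent family has only one linear relation with coefficient sum one, so the
signed minors, which form a relation, are proportional to the weights `l`. -/
theorem AffineIndependent.signedMinor_eq {v : Fin (d + 1) → EuclideanSpace ℝ (Fin d)}
    (hv : AffineIndependent ℝ v) {l : Fin (d + 1) → ℝ} (hl : ∑ i, l i = 1)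
    (hlv : ∀ k, ∑ i, l i * v i k = 0) (j : Fin (d + 1)) :
    signedMinor (coordMatrix v) j = l j * (consCol (fun _ => 1) (coordMatrix v)).det := by
  rw [affineIndependent_iff] at hv
  set D := (consCol (fun _ => 1) (coordMatrix v)).det with hD
  have hD' : ∑ i, signedMinor (coordMatrix v) i = D := by
    rw [hD, det_consCol]; simp
  have := hv Finset.univ (fun i => signedMinor (coordMatrix v) i - l i * D) ?_ ?_ j
    (Finset.mem_univ j)
  · linarith
  · rw [Finset.sum_sub_distrib, hD', ← Finset.sum_mul, hl]; ring
  · ext k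
    simp only [PiLp.zero_apply, WithLp.ofLp_sum, Finset.sum_apply, PiLp.smul_apply, smul_eq_mul,
      sub_mul, Finset.sum_sub_distrib]
    have h1 := sum_signedMinor_mul (coordMatrix v) k
    have h2 : ∑ i, l i * D * v i k = 0 := by
      simp_rw [mul_right_comm _ D]
      rw [← Finset.sum_mul, hlv, zero_mul]
    simp only [coordMatrix, Matrix.of_apply] at h1 ⊢
    rw [h1, h2, sub_zero]

/-- A sum over pairs `i < j` of a symmetric function vanishing on the diagonal is half of the sum over
all pairs. -/
theorem two_mul_sum_lt_eq_sum {n : ℕ} (f : Fin n → Fin n → ℝ) (hs : ∀ i j, f i j = f j i)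
    (h0 : ∀ i, f i i = 0) :
    2 * ∑ e : {e : Fin n × Fin n // e.1 < e.2}, f e.1.1 e.1.2 = ∑ i, ∑ j, f i j := by
  have h1 : ∑ e : {e : Fin n × Fin n // e.1 < e.2}, f e.1.1 e.1.2
      = ∑ i, ∑ j, if i < j then f i j else 0 := by
    rw [← Fintype.sum_prod_type', ← Finset.sum_filter]
    exact (Finset.sum_subtype (Finset.univ.filter fun e : Fin n × Fin n => e.1 < e.2)
      (by simp) fun e => f e.1 e.2).symm
  have h2 : ∑ i, ∑ j, f i j = (∑ i, ∑ j, if i < j then f i j else 0)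
      + ∑ i, ∑ j, if j < i then f j i else 0 := by
    simp only [← Finset.sum_add_distrib]
    refine Finset.sum_congr rfl fun i _ => Finset.sum_congr rfl fun j _ => ?_
    rcases lt_trichotomy i j with h | rfl | h
    · simp [h, h.not_gt]
    · simp [h0]
    · simp [h, h.not_gt, hs i j]
  rw [h2, Finset.sum_comm (f := fun i j => if j < i then f j i else 0), h1]
  ring

theorem sum_dotProduct_sub_of_sum_eq_zero {n : ℕ} (W : Matrix (Fin n) (Fin d) ℝ)
    (hW : ∀ k, ∑ i, W i k = 0) :
    ∑ e : {e : Fin n × Fin n // e.1 < e.2}, (W e.1.1 - W e.1.2) ⬝ᵥ (W e.1.1 - W e.1.2)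
      = n * ∑ i, W i ⬝ᵥ W i := by
  have h := two_mul_sum_lt_eq_sum (fun i j => (W i - W j) ⬝ᵥ (W i - W j))
    (fun i j => by rw [← neg_sub (W j), neg_dotProduct_neg]) (fun i => by simp)
  have hW' : ∀ i, ∑ j, W i ⬝ᵥ W j = 0 := by
    intro i
    simp only [dotProduct]
    rw [Finset.sum_comm]
    simp [← Finset.mul_sum, hW]
  have h2 : ∑ i, ∑ j, (W i - W j) ⬝ᵥ (W i - W j) = 2 * (n * ∑ i, W i ⬝ᵥ W i) := by
    have : ∀ i j, (W i - W j) ⬝ᵥ (W i - W j) = W i ⬝ᵥ W i - 2 * (W i ⬝ᵥ W j) + W j ⬝ᵥ W j := by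
      intro i j
      simp only [sub_dotProduct, dotProduct_sub, dotProduct_comm (W j) (W i)]
      ring
    simp only [this, Finset.sum_add_distrib, Finset.sum_sub_distrib, ← Finset.mul_sum,
      hW']
    simp only [Finset.sum_const, Finset.card_univ, Fintype.card_fin, nsmul_eq_mul,
      ← Finset.mul_sum]
    ring
  linarith

theorem dist_sq_eq_dotProduct (x y : EuclideanSpace ℝ (Fin d)) :
    dist x y ^ 2 = (x.ofLp - y.ofLp) ⬝ᵥ (x.ofLp - y.ofLp) := by
  rw [EuclideanSpace.dist_eq, Real.sq_sqrt (Finset.sum_nonneg fun i _ => sq_nonneg _)]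
  simp [dotProduct, Real.dist_eq, sq]

/-! ### Vertices and regularity of a full-dimensional simplex -/

namespace Affine.Simplex

variable (T : Affine.Simplex ℝ (EuclideanSpace ℝ (Fin d)) d)

/-- The vertices of a full-dimensional simplex, as an affine basis of the space. -/
def affineBasis : AffineBasis (Fin (d + 1)) ℝ (EuclideanSpace ℝ (Fin d)) :=
  ⟨T.points, T.independent, T.independent.affineSpan_eq_top_iff_card_eq_finrank_add_one.2 (by simp)⟩

@[simp] theorem coe_affineBasis : ⇑T.affineBasis = T.points := rfl

/-- The vertices of a simplex are extreme points of its convex hull, as barycentric coordinates are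
nonnegative on the hull. -/
theorem points_mem_extremePoints (i : Fin (d + 1)) :
    T.points i ∈ (convexHull ℝ (Set.range T.points)).extremePoints ℝ := by
  have hhull := T.affineBasis.convexHull_eq_nonneg_coord
  rw [coe_affineBasis] at hhull
  rw [mem_extremePoints_iff_left]
  refine ⟨subset_convexHull ℝ _ ⟨i, rfl⟩, fun x hx y hy hxy => ?_⟩
  obtain ⟨a, b, ha, hb, hab, hxy⟩ := hxy
  rw [hhull] at hx hy
  apply T.affineBasis.ext_elem
  have hne : ∀ j, j ≠ i → T.affineBasis.coord j x = 0 := by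
    intro j hj
    have h1 : T.affineBasis.coord j (T.points i) = 0 := by
      rw [← coe_affineBasis, T.affineBasis.coord_apply_ne hj]
    rw [← hxy, Convex.combo_affine_apply hab] at h1
    have h2 := hx j
    have h3 := hy j
    simp only [smul_eq_mul] at h1
    have : a * T.affineBasis.coord j x = 0 := by nlinarith [mul_nonneg ha.le h2, mul_nonneg hb.le h3]
    exact (mul_eq_zero.1 this).resolve_left ha.ne'
  intro j
  rw [← coe_affineBasis, T.affineBasis.coord_apply]
  split_ifs with h
  · subst h
    rw [← T.affineBasis.sum_coord_apply_eq_one x]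
    exact (Finset.sum_eq_single j (fun k _ hk => hne k hk) (by simp)).symm
  · exact hne j h

/-- In an equilateral simplex, permuting barycentric coordinates is an isometry, because the distance
of two points is a symmetric function of their coordinates and of the edge lengths. -/
theorem regular_iff_equilateral : T.Regular ↔ T.Equilateral := by
  refine ⟨Regular.equilateral, fun ⟨r, hr⟩ σ => ?_⟩
  set b := T.affineBasis
  set f : Equiv.Perm (Fin (d + 1)) → EuclideanSpace ℝ (Fin d) → EuclideanSpace ℝ (Fin d) :=
    fun τ y => Finset.univ.affineCombination ℝ T.points fun i => b.coord (τ.symm i) y with hf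
  have hsum : ∀ (τ : Equiv.Perm (Fin (d + 1))) y, ∑ i, b.coord (τ.symm i) y = 1 := fun τ y => by
    rw [Equiv.sum_comp τ.symm fun i => b.coord i y, b.sum_coord_apply_eq_one]
  have hcoord : ∀ τ y i, b.coord i (f τ y) = b.coord (τ.symm i) y := fun τ y i =>
    b.coord_apply_combination_of_mem (Finset.mem_univ i) (hsum τ y)
  have hinv : ∀ τ y, f τ.symm (f τ y) = y := fun τ y => b.ext_elem fun i => by
    rw [hcoord, hcoord]; simp
  have hdist : ∀ i j k l, (i = j ↔ k = l) →
      dist (T.points i) (T.points j) = dist (T.points k) (T.points l) := by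
    intro i j k l h
    by_cases hij : i = j
    · simp [hij, h.1 hij]
    · rw [hr i j hij, hr k l (mt h.2 hij)]
  have hiso : Isometry (f σ) := Isometry.of_dist_eq fun y z => by
    have h1 := EuclideanGeometry.dist_affineCombination T.points (hsum σ y) (hsum σ z)
    have h2 := EuclideanGeometry.dist_affineCombination T.points
      (b.sum_coord_apply_eq_one y) (b.sum_coord_apply_eq_one z)
    rw [← coe_affineBasis, b.affineCombination_coord_eq_self,
      b.affineCombination_coord_eq_self] at h2
    rw [← abs_of_nonneg (dist_nonneg (x := f σ y)), ← abs_of_nonneg (dist_nonneg (x := y)),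
      ← sq_eq_sq_iff_abs_eq_abs, sq, sq, h2]
    refine h1.trans ?_
    congr 2
    rw [← Equiv.sum_comp σ]
    refine Finset.sum_congr rfl fun i _ => ?_
    rw [← Equiv.sum_comp σ]
    refine Finset.sum_congr rfl fun j _ => ?_
    rw [coe_affineBasis, hdist (σ i) (σ j) i j (by simp)]
    simp
  refine ⟨⟨⟨f σ, f σ.symm, hinv σ, fun y => by simpa using hinv σ.symm y⟩, hiso⟩, ?_⟩
  ext1 i
  refine b.ext_elem fun j => ?_
  change b.coord j (b (σ i)) = b.coord j (f σ (b i))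
  rw [hcoord, b.coord_apply, b.coord_apply]
  simp [Equiv.symm_apply_eq]

theorem coneVolumes_eq (j : Fin (d + 1)) :
    coneVolumes T j = |signedMinor (coordMatrix T.points) j| / d.factorial := by
  have h : T.points '' {j}ᶜ = Set.range (T.points ∘ j.succAbove) := by
    rw [Set.range_comp, Fin.range_succAbove]
  rw [coneVolumes, h, volume_real_convexHull_insert_zero_range, signedMinor, abs_mul, abs_pow,
    abs_neg, abs_one, one_pow, one_mul]
  rfl

/-- The sum of the squared edge lengths in terms of the vertices translated to have centroid `0`. -/
theorem sum_edgeLengths_sq (W : Matrix (Fin (d + 1)) (Fin d) ℝ) (g : Fin d → ℝ)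
    (hWT : ∀ i, W i = (T.points i).ofLp - g) (hW : ∀ k, ∑ i, W i k = 0) :
    ∑ e, edgeLengths T e ^ 2 = (d + 1) * ∑ i, W i ⬝ᵥ W i := by
  have := sum_dotProduct_sub_of_sum_eq_zero W hW
  push_cast at this
  rw [← this]
  refine Finset.sum_congr rfl fun e _ => ?_
  rw [edgeLengths, dist_sq_eq_dotProduct, hWT, hWT]
  simp

end Affine.Simplex

/-! ### The two extreme cases of the inequality -/

namespace Affine.Simplex

variable {T : Affine.Simplex ℝ (EuclideanSpace ℝ (Fin d)) d}

/-- The barycentric coordinates of an interior origin are positive. -/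
theorem exists_pos_weights_of_zero_mem_interior
    (h0 : 0 ∈ interior (convexHull ℝ (Set.range T.points))) :
    ∃ l : Fin (d + 1) → ℝ, (∀ i, 0 < l i) ∧ ∑ i, l i = 1 ∧
      ∀ k, ∑ i, l i * coordMatrix T.points i k = 0 := by
  have h := T.affineBasis.interior_convexHull
  rw [coe_affineBasis] at h
  rw [h] at h0
  refine ⟨fun i => T.affineBasis.coord i 0, h0, T.affineBasis.sum_coord_apply_eq_one 0,
    fun k => ?_⟩
  have := congrArg (fun x : EuclideanSpace ℝ (Fin d) => x k)
    (T.affineBasis.linear_combination_coord_eq_self 0)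
  simpa [coordMatrix] using this

/-- The cone volumes are proportional to the barycentric coordinates `l` of the origin. -/
theorem coneVolumes_eq_weight_mul {l : Fin (d + 1) → ℝ} (hl : ∀ i, 0 < l i) (hl1 : ∑ i, l i = 1)
    (hlv : ∀ k, ∑ i, l i * coordMatrix T.points i k = 0) (j : Fin (d + 1)) :
    coneVolumes T j
      = l j * (|(consCol (fun _ => 1) (coordMatrix T.points)).det| / d.factorial) := by
  rw [coneVolumes_eq, T.independent.signedMinor_eq hl1 hlv, abs_mul, abs_of_pos (hl j), mul_div_assoc]

theorem dist_sq_points (i j : Fin (d + 1)) :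
    dist (T.points i) (T.points j) ^ 2 = coordMatrix T.points i ⬝ᵥ coordMatrix T.points i
      - 2 * (coordMatrix T.points i ⬝ᵥ coordMatrix T.points j)
      + coordMatrix T.points j ⬝ᵥ coordMatrix T.points j := by
  rw [dist_sq_eq_dotProduct, sub_dotProduct, dotProduct_sub, dotProduct_sub,
    dotProduct_comm (T.points j).ofLp (T.points i).ofLp]
  simp only [coordMatrix_apply]
  ring

theorem equilateral_of_dist_sq {r : ℝ}
    (h : ∀ i j, i ≠ j → dist (T.points i) (T.points j) ^ 2 = r) : T.Equilateral :=
  ⟨√r, fun i j hij => by rw [← h i j hij, Real.sqrt_sq dist_nonneg]⟩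

theorem sum_edgeLengths_sq_pos (hd : d ≠ 0) : 0 < ∑ e, edgeLengths T e ^ 2 := by
  have : Nonempty {e : Fin (d + 1) × Fin (d + 1) // e.1 < e.2} :=
    ⟨⟨(0, Fin.last d), Fin.pos_iff_ne_zero.2 (by simpa [Fin.ext_iff] using hd)⟩⟩
  exact Finset.sum_pos (fun e _ => pow_pos (dist_pos.2 (T.independent.injective.ne e.2.ne)) 2)
    Finset.univ_nonempty

/-- The case of exponent one: up to the factor `d!`, the determinant is the volume of the simplex.
The vertices are translated to have centroid `0`, so that the constant column is orthogonal to
the others. -/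
theorem det_sq_le_of_edgeLengths (hd : d ≠ 0) :
    (consCol (fun _ => 1) (coordMatrix T.points)).det ^ 2
        ≤ (d + 1) * ((∑ e, edgeLengths T e ^ 2) / (d * (d + 1))) ^ d ∧
      ((consCol (fun _ => 1) (coordMatrix T.points)).det ^ 2
        = (d + 1) * ((∑ e, edgeLengths T e ^ 2) / (d * (d + 1))) ^ d → T.Equilateral) := by
  set g : Fin d → ℝ := fun k => (∑ i, coordMatrix T.points i k) / (d + 1) with hg
  set W : Matrix (Fin (d + 1)) (Fin d) ℝ := Matrix.of fun i => coordMatrix T.points i - g with hWdef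
  have hW : ∀ k, ∑ i, W i k = 0 := by
    intro k
    simp only [hWdef, Matrix.of_apply, Pi.sub_apply, Finset.sum_sub_distrib, hg]
    simp
    field_simp
    ring
  have hW1 : ∀ k, ∑ i, (1 : ℝ) * W i k = 0 := by simpa using hW
  have hF := T.sum_edgeLengths_sq W g (fun i => rfl) hW
  have hFpos := T.sum_edgeLengths_sq_pos hd
  have hs : ∑ _i : Fin (d + 1), (1 : ℝ) ^ 2 = d + 1 := by simp
  have htr : (∑ e, edgeLengths T e ^ 2) / (d * (d + 1)) = (∑ i, W i ⬝ᵥ W i) / d := by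
    rw [hF]; field_simp
  rw [← det_consCol_sub_const _ g, htr, ← hs]
  refine ⟨det_consCol_sq_le hd _ W hW1, fun h => ?_⟩
  have hpos : 0 < ∑ i, W i ⬝ᵥ W i := by
    rw [hF] at hFpos
    exact pos_of_mul_pos_right hFpos (by positivity)
  have key := dotProduct_eq_of_det_consCol_sq_eq hd _ W hW1 (by rw [hs]; positivity) hpos h
  refine equilateral_of_dist_sq (r := 2 * ((∑ i, W i ⬝ᵥ W i) / d)) fun i j hij => ?_
  have : (T.points i).ofLp - (T.points j).ofLp = W i - W j :=
    (sub_sub_sub_cancel_right _ _ g).symm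
  rw [dist_sq_eq_dotProduct, this, sub_dotProduct, dotProduct_sub, dotProduct_sub,
    key i i, key i j, key j i, key j j]
  simp only [if_neg hij, if_neg hij.symm, if_true]
  ring

/-- The case of exponent two: up to the factor `d! ^ 2`, the left-hand side is the sum of the
squared cone volumes. The weights of the origin are the column orthogonal to the coordinates of the
vertices. -/
theorem det_sq_mul_le_of_norm_eq_one (hd : d ≠ 0)
    (h1 : ∀ i, coordMatrix T.points i ⬝ᵥ coordMatrix T.points i = 1)
    {l : Fin (d + 1) → ℝ} (hl : ∀ i, 0 < l i) (hl1 : ∑ i, l i = 1)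
    (hlv : ∀ k, ∑ i, l i * coordMatrix T.points i k = 0) :
    (consCol (fun _ => 1) (coordMatrix T.points)).det ^ 2 * ∑ i, l i ^ 2 ≤ ((d + 1) / d) ^ d ∧
      ((consCol (fun _ => 1) (coordMatrix T.points)).det ^ 2 * ∑ i, l i ^ 2 = ((d + 1) / d) ^ d →
        T.Equilateral) := by
  set D := (consCol (fun _ => 1) (coordMatrix T.points)).det with hD
  have hs : 0 < ∑ i, l i ^ 2 := Finset.sum_pos (fun i _ => pow_pos (hl i) 2) Finset.univ_nonempty
  have htr : ∑ i, coordMatrix T.points i ⬝ᵥ coordMatrix T.points i = (d : ℝ) + 1 := by simp [h1]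
  have hdet : (consCol l (coordMatrix T.points)).det ^ 2
      = (∑ i, l i ^ 2) * (D ^ 2 * ∑ i, l i ^ 2) := by
    have : (consCol l (coordMatrix T.points)).det = (∑ i, l i ^ 2) * D := by
      rw [det_consCol, Finset.sum_mul]
      refine Finset.sum_congr rfl fun i _ => ?_
      rw [T.independent.signedMinor_eq hl1 hlv, ← hD]; ring
    rw [this]; ring
  constructor
  · have := det_consCol_sq_le hd l _ hlv
    rw [hdet, htr] at this
    exact le_of_mul_le_mul_left this hs
  · intro h
    have key := dotProduct_eq_of_det_consCol_sq_eq hd l _ hlv hs (by rw [htr]; positivity)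
      (by rw [hdet, htr, h])
    rw [htr] at key
    -- The vertices have the same norm, so the diagonal of the Gram matrix forces equal weights.
    have hlc : ∀ i j, l i = l j := by
      intro i j
      have hi := key i i
      have hj := key j j
      rw [h1, if_pos rfl] at hi hj
      have hc : ((d : ℝ) + 1) / d ≠ 0 := by positivity
      have h2 := mul_left_cancel₀ hc (hi.symm.trans hj)
      have h3 : l i * l i = l j * l j := by
        field_simp at h2
        linarith
      nlinarith [hl i, hl j, mul_self_eq_mul_self_iff.1 h3]
    refine equilateral_of_dist_sq (r := 2 - 2 * (((d : ℝ) + 1) / d *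
      (0 - l 0 * l 0 / ∑ i, l i ^ 2))) fun i j hij => ?_
    rw [dist_sq_points, h1, h1, key i j, if_neg hij, hlc i 0, hlc j 0]
    ring

/-- A full-dimensional equilateral simplex with vertices on the unit sphere has its centroid at the
origin, and its volume and edge lengths attain both determinant bounds. -/
theorem Equilateral.weights_eq_and_det_sq (he : T.Equilateral) (hd : d ≠ 0)
    (h1 : ∀ i, coordMatrix T.points i ⬝ᵥ coordMatrix T.points i = 1)
    {l : Fin (d + 1) → ℝ} (hl1 : ∑ i, l i = 1)
    (hlv : ∀ k, ∑ i, l i * coordMatrix T.points i k = 0) :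
    (∀ i, l i = 1 / (d + 1)) ∧
      (consCol (fun _ => 1) (coordMatrix T.points)).det ^ 2 = (d + 1) * ((d + 1) / d) ^ d ∧
      ∑ e, edgeLengths T e ^ 2 = (d + 1) ^ 2 := by
  obtain ⟨r, hr⟩ := he
  have hd' : (d : ℝ) ≠ 0 := by exact_mod_cast hd
  have hdpos : (0 : ℝ) < d := by positivity
  set a := 1 - r ^ 2 / 2 with ha
  have hdot : ∀ i j, i ≠ j → coordMatrix T.points i ⬝ᵥ coordMatrix T.points j = a := by
    intro i j hij
    have := T.dist_sq_points i j
    rw [h1, h1, hr i j hij] at this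
    rw [ha]; linarith
  -- Pair the relation `∑ l i • v i = 0` with the vertex `v j`.
  have hla : ∀ j, l j * (1 - a) = -a := by
    intro j
    have h2 : ∑ i, l i * (coordMatrix T.points i ⬝ᵥ coordMatrix T.points j) = 0 := by
      simp only [dotProduct, Finset.mul_sum, ← mul_assoc]
      rw [Finset.sum_comm]
      simp only [← Finset.sum_mul, hlv, zero_mul, Finset.sum_const_zero]
    have h3 : ∀ i, l i * (coordMatrix T.points i ⬝ᵥ coordMatrix T.points j)
        = l i * a + if i = j then l j * (1 - a) else 0 := by
      intro i
      split_ifs with h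
      · rw [h, h1]; ring
      · rw [hdot i j h, add_zero]
    simp only [h3, Finset.sum_add_distrib, ← Finset.sum_mul, hl1, Finset.sum_ite_eq',
      Finset.mem_univ, if_true] at h2
    linarith
  have hda : d * a = -1 := by
    have := Finset.sum_congr rfl fun j (_ : j ∈ Finset.univ) => hla j
    rw [← Finset.sum_mul, hl1] at this
    simp at this
    linarith
  have ha' : a = -(1 / d) := by field_simp; linarith
  have hl : ∀ i, l i = 1 / (d + 1) := by
    intro i
    have := hla i
    rw [ha'] at this
    field_simp at this ⊢
    linarith
  refine ⟨hl, ?_, ?_⟩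
  -- The vertices have mutual inner products `-1 / d`; adjoining a constant coordinate of square
  -- `1 / d` makes them orthogonal.
  · set t := √(1 / (d : ℝ)) with ht
    have ht2 : t ^ 2 = 1 / d := Real.sq_sqrt (by positivity)
    have hC : consCol (fun _ => t) (coordMatrix T.points)
        * (consCol (fun _ => t) (coordMatrix T.points))ᵀ
        = (((d : ℝ) + 1) / d) • (1 : Matrix _ _ ℝ) := by
      ext i j
      rw [Matrix.mul_apply, Fin.sum_univ_succ]
      simp only [Matrix.transpose_apply, consCol, Matrix.of_apply, Fin.cons_zero, Fin.cons_succ,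
        Matrix.smul_apply, Matrix.one_apply, smul_eq_mul]
      change t * t + coordMatrix T.points i ⬝ᵥ coordMatrix T.points j = _
      rw [← sq, ht2]
      split_ifs with h
      · rw [h, h1]; field_simp
        ring
      · rw [hdot i j h, ha']; ring
    have hdet := congrArg Matrix.det hC
    have htD : (consCol (fun _ => t) (coordMatrix T.points)).det
        = t * (consCol (fun _ => 1) (coordMatrix T.points)).det := by
      simp [det_consCol, Finset.mul_sum]
    rw [Matrix.det_mul, Matrix.det_transpose, Matrix.det_smul, Matrix.det_one, Fintype.card_fin,
      htD, show ∀ D : ℝ, t * D * (t * D) = t ^ 2 * D ^ 2 from fun D => by ring, ht2, pow_succ] at hdet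
    field_simp at hdet
    rw [hdet, pow_succ]
    field_simp
  · have hW : ∀ k, ∑ i, coordMatrix T.points i k = 0 := by
      intro k
      have := hlv k
      simp only [hl, ← Finset.mul_sum] at this
      exact (mul_eq_zero.1 this).resolve_left (by positivity)
    rw [T.sum_edgeLengths_sq (coordMatrix T.points) 0 (fun i => by simp [coordMatrix_apply]) hW]
    simp [h1]
    ring

end Affine.Simplex

/-! ### Interpolation between the exponents one and two -/

/-- Log-convexity of the `ℓ_p` norms between the exponents one and two. -/
theorem ellNorm_le_of_nonneg {ι : Type*} [Fintype ι] {p : ℝ} (hp₁ : 1 ≤ p) (hp₂ : p ≤ 2)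
    {V : ι → ℝ} (hV : ∀ i, 0 ≤ V i) :
    ellNorm p V ≤ ((∑ i, V i) ^ 2) ^ (1 / p - 1 / 2) * (∑ i, V i ^ 2) ^ (1 - 1 / p) := by
  have hp : 0 < p := by linarith
  have hS : 0 ≤ ∑ i, V i := Finset.sum_nonneg fun i _ => hV i
  have hQ : 0 ≤ ∑ i, V i ^ 2 := Finset.sum_nonneg fun i _ => sq_nonneg _
  have key : ∑ i, V i ^ p ≤ (∑ i, V i) ^ (2 - p) * (∑ i, V i ^ 2) ^ (p - 1) := by
    rcases hp₁.eq_or_lt with rfl | hp1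
    · norm_num [Real.rpow_one]
    · have h := Real.inner_le_weight_mul_Lp_of_nonneg Finset.univ (p := (p - 1)⁻¹)
        (by rw [one_le_inv₀ (by linarith)]; linarith) V (fun i => V i ^ (p - 1))
        (hV) (fun i => Real.rpow_nonneg (hV i) _)
      have h1 : ∀ i, V i * V i ^ (p - 1) = V i ^ p := fun i => by
        rw [← Real.rpow_one_add' (hV i) (by linarith), add_sub_cancel]
      have h2 : ∀ i, V i * (V i ^ (p - 1)) ^ (p - 1)⁻¹ = V i ^ 2 := fun i => by
        rw [← Real.rpow_mul (hV i), mul_inv_cancel₀ (by linarith), Real.rpow_one, sq]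
      rw [inv_inv] at h
      simp only [h1, h2] at h
      rwa [show 2 - p = 1 - (p - 1) by ring]
  rw [ellNorm]
  have habs : ∑ j, |V j| ^ p = ∑ j, V j ^ p :=
    Finset.sum_congr rfl fun j _ => by rw [abs_of_nonneg (hV j)]
  rw [habs]
  refine (Real.rpow_le_rpow (Finset.sum_nonneg fun i _ => Real.rpow_nonneg (hV i) _) key
    (by positivity)).trans_eq ?_
  rw [Real.mul_rpow (Real.rpow_nonneg hS _) (Real.rpow_nonneg hQ _), ← Real.rpow_mul hS,
    ← Real.rpow_mul hQ, ← Real.rpow_natCast, ← Real.rpow_mul hS]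
  congr 2
  · push_cast; field_simp
  · field_simp

/-- Interpolation between the exponents one and two is exact for constant vectors. -/
theorem ellNorm_eq_of_const {ι : Type*} [Fintype ι] [Nonempty ι] {p : ℝ} (hp : p ≠ 0)
    {V : ι → ℝ} {x : ℝ} (hx : 0 < x) (hV : ∀ i, V i = x) :
    ellNorm p V = ((∑ i, V i) ^ 2) ^ (1 / p - 1 / 2) * (∑ i, V i ^ 2) ^ (1 - 1 / p) := by
  have hn : (0 : ℝ) < Fintype.card ι := by exact_mod_cast Fintype.card_pos
  simp only [ellNorm, hV, abs_of_pos hx, Finset.sum_const, Finset.card_univ, nsmul_eq_mul]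
  apply Real.log_injOn_pos (Set.mem_Ioi.2 (by positivity)) (Set.mem_Ioi.2 (by positivity))
  rw [Real.log_rpow (by positivity), Real.log_mul (by positivity) (by positivity),
    Real.log_rpow hx, Real.log_mul (by positivity) (by positivity), Real.log_rpow (by positivity),
    Real.log_rpow (by positivity), Real.log_pow, Real.log_mul (by positivity) (by positivity),
    Real.log_mul (by positivity) (by positivity), Real.log_pow]
  push_cast
  field_simp
  ring

theorem ellNorm_two_edgeLengths {T : Affine.Simplex ℝ (EuclideanSpace ℝ (Fin d)) d} :
    ellNorm 2 (edgeLengths T) = (∑ e, edgeLengths T e ^ 2) ^ (1 / 2 : ℝ) := by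
  simp [ellNorm]

/-- The constant for the exponent `p` is the interpolation of the squared constants for the exponents
one and two. -/
theorem bound_eq_interpolation (hd : d ≠ 0) {p F : ℝ} (hp : p ≠ 0) (hF : 0 < F) :
    ((d : ℝ) + 1) ^ ((3 * (d : ℝ) - 1) / 2 - (2 * (d : ℝ) - 1) / p) /
        ((d.factorial : ℝ) * (d : ℝ) ^ ((d : ℝ) / 2)) *
        (F ^ (1 / 2 : ℝ)) ^ ((d : ℝ) * (2 / p - 1))
      = (((d : ℝ) + 1) * (F / (d * (d + 1))) ^ d / (d.factorial : ℝ) ^ 2) ^ (1 / p - 1 / 2) *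
        ((((d : ℝ) + 1) / d) ^ d / (d.factorial : ℝ) ^ 2) ^ (1 - 1 / p) := by
  have hd0 : (0 : ℝ) < d := by positivity
  apply Real.log_injOn_pos (Set.mem_Ioi.2 (by positivity)) (Set.mem_Ioi.2 (by positivity))
  rw [Real.log_mul (by positivity) (by positivity), Real.log_div (by positivity) (by positivity),
    Real.log_mul (by positivity) (by positivity), Real.log_mul (by positivity) (by positivity),
    Real.log_rpow (by positivity), Real.log_rpow (by positivity), Real.log_rpow (by positivity),
    Real.log_rpow (by positivity), Real.log_rpow (by positivity), Real.log_rpow (by positivity),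
    Real.log_div (by positivity) (by positivity), Real.log_div (by positivity) (by positivity),
    Real.log_mul (by positivity) (by positivity), Real.log_pow, Real.log_pow, Real.log_pow,
    Real.log_div (by positivity) (by positivity), Real.log_div (by positivity) (by positivity),
    Real.log_mul (by positivity) (by positivity)]
  push_cast
  field_simp
  ring

end

/-! ### The inequality for intermediate exponents -/

open Matrix in
theorem mainTheorem2 (d : ℕ) (T : Affine.Simplex ℝ (EuclideanSpace ℝ (Fin d)) d)
    (hT : convexHull ℝ (Set.range T.points) ∈ InscribedPolytopes d)
    (p : ℝ) (hp₁ : 1 ≤ p) (hp₂ : p ≤ 2) :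
    ellNorm p (coneVolumes T) ≤
        ((d : ℝ) + 1) ^ ((3 * (d : ℝ) - 1) / 2 - (2 * (d : ℝ) - 1) / p) /
            ((d.factorial : ℝ) * (d : ℝ) ^ ((d : ℝ) / 2)) *
          ellNorm 2 (edgeLengths T) ^ ((d : ℝ) * (2 / p - 1)) ∧
      (ellNorm p (coneVolumes T) =
        ((d : ℝ) + 1) ^ ((3 * (d : ℝ) - 1) / 2 - (2 * (d : ℝ) - 1) / p) /
            ((d.factorial : ℝ) * (d : ℝ) ^ ((d : ℝ) / 2)) *
          ellNorm 2 (edgeLengths T) ^ ((d : ℝ) * (2 / p - 1)) ↔ T.Regular) := by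
  obtain ⟨-, hext, h0, -⟩ := hT
  have hnorm : ∀ i, ‖T.points i‖ = 1 := fun i => by
    simpa using hext (T.points_mem_extremePoints i)
  -- In dimension zero the unit sphere is empty.
  have hd : d ≠ 0 := by
    rintro rfl
    have := hnorm 0
    rw [Subsingleton.elim (T.points 0) 0, norm_zero] at this
    exact zero_ne_one this
  have h1 : ∀ i, coordMatrix T.points i ⬝ᵥ coordMatrix T.points i = 1 := fun i => by
    have := dist_sq_eq_dotProduct (T.points i) 0
    rw [dist_zero_right, hnorm] at this
    simpa [coordMatrix_apply] using this.symm
  obtain ⟨l, hl, hl1, hlv⟩ := T.exists_pos_weights_of_zero_mem_interior h0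
  set D := (consCol (fun _ => 1) (coordMatrix T.points)).det with hD
  have hcone := T.coneVolumes_eq_weight_mul hl hl1 hlv
  rw [← hD] at hcone
  obtain ⟨hA, hAeq⟩ := T.det_sq_le_of_edgeLengths hd
  obtain ⟨hB, hBeq⟩ := T.det_sq_mul_le_of_norm_eq_one hd h1 hl hl1 hlv
  rw [← hD] at hA hAeq hB hBeq
  have hp : 0 < p := by linarith
  have hd0 : (0 : ℝ) < d := by positivity
  have hfac : (0 : ℝ) < (d.factorial : ℝ) ^ 2 := by positivity
  have hFpos := T.sum_edgeLengths_sq_pos hd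
  have hS : (∑ i, coneVolumes T i) ^ 2 = D ^ 2 / (d.factorial : ℝ) ^ 2 := by
    simp only [hcone, ← Finset.sum_mul, hl1, one_mul, div_pow, sq_abs]
  have hQ : ∑ i, coneVolumes T i ^ 2 = (D ^ 2 * ∑ i, l i ^ 2) / (d.factorial : ℝ) ^ 2 := by
    simp only [hcone, mul_pow, ← Finset.sum_mul, div_pow, sq_abs]
    ring
  have hV : ∀ i, 0 ≤ coneVolumes T i := fun i => measureReal_nonneg
  have hle := ellNorm_le_of_nonneg hp₁ hp₂ hV
  rw [ellNorm_two_edgeLengths, bound_eq_interpolation hd hp.ne' hFpos, T.regular_iff_equilateral]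
  set A := ((d : ℝ) + 1) * ((∑ e, edgeLengths T e ^ 2) / (d * (d + 1))) ^ d with hAdef
  set B := (((d : ℝ) + 1) / d) ^ d with hBdef
  have hBpos : 0 < B := by positivity
  have hα : 0 ≤ 1 / p - 1 / 2 := sub_nonneg.2 (one_div_le_one_div_of_le hp hp₂)
  have hβ : 0 ≤ 1 - 1 / p := sub_nonneg.2 (by rw [div_le_one hp]; exact hp₁)
  rw [hS, hQ] at hle
  have hA' : D ^ 2 / (d.factorial : ℝ) ^ 2 ≤ A / (d.factorial : ℝ) ^ 2 := by gcongr
  have hS0 : 0 ≤ D ^ 2 / (d.factorial : ℝ) ^ 2 := by positivity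
  have hQ0 : 0 ≤ D ^ 2 * (∑ i, l i ^ 2) / (d.factorial : ℝ) ^ 2 := by positivity
  have hQle : (D ^ 2 * (∑ i, l i ^ 2) / (d.factorial : ℝ) ^ 2) ^ (1 - 1 / p)
      ≤ (B / (d.factorial : ℝ) ^ 2) ^ (1 - 1 / p) := by gcongr
  have hSle : (D ^ 2 / (d.factorial : ℝ) ^ 2) ^ (1 / p - 1 / 2)
      ≤ (A / (d.factorial : ℝ) ^ 2) ^ (1 / p - 1 / 2) := by gcongr
  have hle2 := mul_le_mul hSle hQle (Real.rpow_nonneg hQ0 _) (Real.rpow_nonneg (hS0.trans hA') _)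
  refine ⟨hle.trans hle2, fun h => ?_, fun he => ?_⟩
  · rw [h] at hle
    by_contra hne
    -- For `p = 2` the bound for the exponent one has weight zero, so the other one must be used.
    rcases hα.eq_or_lt with h0 | hα'
    · have hβ' : 0 < 1 - 1 / p := by linarith
      have hlt : (D ^ 2 * (∑ i, l i ^ 2) / (d.factorial : ℝ) ^ 2) ^ (1 - 1 / p)
          < (B / (d.factorial : ℝ) ^ 2) ^ (1 - 1 / p) := by
        have : D ^ 2 * ∑ i, l i ^ 2 < B := lt_of_le_of_ne hB fun h => hne (hBeq h)
        gcongr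
      rw [← h0, Real.rpow_zero, Real.rpow_zero, one_mul, one_mul] at hle
      exact hle.not_gt hlt
    · have hlt : (D ^ 2 / (d.factorial : ℝ) ^ 2) ^ (1 / p - 1 / 2)
          < (A / (d.factorial : ℝ) ^ 2) ^ (1 / p - 1 / 2) := by
        have : D ^ 2 < A := lt_of_le_of_ne hA fun h => hne (hAeq h)
        gcongr
      exact hle.not_gt (mul_lt_mul_of_lt_of_le_of_nonneg_of_pos hlt hQle
        (Real.rpow_nonneg hS0 _) (by positivity))
  · obtain ⟨hlc, hD2, hF2⟩ := he.weights_eq_and_det_sq hd h1 hl1 hlv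
    rw [← hD] at hD2
    have hDne : D ≠ 0 := by
      rintro h
      rw [h] at hD2
      have : (0 : ℝ) < (d + 1) * ((d + 1) / d) ^ d := by positivity
      rw [← hD2] at this
      simp at this
    have hV' : ∀ i, coneVolumes T i = 1 / (d + 1) * (|D| / d.factorial) := fun i => by
      rw [hcone, hlc]
    rw [ellNorm_eq_of_const hp.ne' (by positivity) hV', hS, hQ]
    have hA2 : D ^ 2 = A := by
      rw [hD2, hAdef, hF2]
      congr 2
      field_simp
    have hB2 : D ^ 2 * ∑ i, l i ^ 2 = B := by
      simp only [hlc, hD2, hBdef]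
      simp
      field_simp
    rw [hB2, hA2]
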